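/- Let $\lambda=\beth_\omega=\sup_n\lambda_n$, where $\lambda_0=\aleph_0$ and $\lambda_{n+1}=2^{\lambda_n}$. For a map $f:M_1\to M_2$ between metric spaces put $w_f(t)=\sup\{d_2(f(x),f(y)): d_1(x,y)\le t\}$ and $\rho_f(t)=\inf\{d_2(f(x),f(y)): d_1(x,y)\ge t\}$; $f$ is a coarse embedding if $w_f(t)<\infty$ for all $t>0$ and $\rho_f(t)\to\infty$ as $t\to\infty$, and a uniform embedding if $w_f(t)\to0$ as $t\to0$ and $\rho_f(t)>0$ for all $t>0$. A long Schauder basic sequence of length $\Lambda$ (an ordinal) is a family $(e_\gamma)_{\gamma<\Lambda}$ such that each $x$ in its closed linear span has a unique expansion $x=\sum_{\gamma<\Lambda}a_\gamma e_\gamma$ as a transfinite series (its partial sums are continuous in the order topology of $[0,\Lambda]$); it is normalized if $\|e_\gamma\|=1$ for all $\gamma$, and monotone if the partial sums of such a series never exceed its sum in norm. Let $X$ be a (real or complex) Banach space whose density (the least cardinality of a dense subset) is at least $\lambda$, and suppose that $X$ admits a coarse embedding or a uniform embedding into $c_0(\Gamma)$ for some set $\Gamma$. Then: 1. $X$ fails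 to have nontrivial cotype, i.e. it does not have cotype $q$ for any $2\le q<\infty$. 2. For every $C>1$, $X$ contains $\ell_\infty^n$ $C$-uniformly: for every $n\in\mathbb{N}$ there are $u_1,\dots,u_n\in X$ that are $C$-equivalent to the unit vector basis of $\ell_\infty^n$, i.e. for some $A,B>0$ with $B\le CA$ we have $A\max_i|a_i|\le\|\sum_{i=1}^n a_iu_i\|\le B\max_i|a_i|$ for all scalars $a_1,\dots,a_n$. 3. $X$ contains a normalized monotone long Schauder basic sequence of length $\lambda$ (regarded as an initial ordinal); and for every such sequence $(e_\gamma)_{\gamma<\lambda}$ in $X$ there is a constant $C>1$ such that for every $n\in\mathbb{N}$ there are ordinals $\alpha_1<\dots<\alpha_n<\lambda$ and $\beta_1<\dots<\beta_n<\lambda$ with $\{\alpha_i\}\cap\{\beta_i\}=\emptyset$ for which $(e_{\alpha_i}-e_{\beta_i})_{i=1}^n$ is $C$-equivalent to the unit vector basis of $\ell_\infty^n$. -/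

import Mathlib

open scoped ENNReal ZeroAtInfty

universe u v w

noncomputable section

namespace CoarseC0

/-- The density of a topological space: the least cardinality of a dense subset. -/
def density (X : Type u) [TopologicalSpace X] : Cardinal.{u} :=
  sInf {c : Cardinal.{u} | ∃ s : Set X, Dense s ∧ Cardinal.mk s = c}

section Embeddings

variable {M : Type u} {N : Type v} [PseudoMetricSpace M] [PseudoMetricSpace N]

/-- The modulus of uniform continuity `w_f(t) = sup {d(f x, f y) : d(x, y) ≤ t}`, in `[0, ∞]`. -/
def modulusOfContinuity (f : M → N) (t : ℝ) : ℝ≥0∞ :=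
  ⨆ (x : M) (y : M) (_ : dist x y ≤ t), edist (f x) (f y)

/-- The modulus of expansion `ρ_f(t) = inf {d(f x, f y) : d(x, y) ≥ t}`, in `[0, ∞]`. -/
def modulusOfExpansion (f : M → N) (t : ℝ) : ℝ≥0∞ :=
  ⨅ (x : M) (y : M) (_ : t ≤ dist x y), edist (f x) (f y)

/-- `f` is a uniform embedding: `w_f(t) → 0` as `t → 0`, and `ρ_f(t) > 0` for all `t > 0`. -/
def IsUniformEmb (f : M → N) : Prop :=
  Filter.Tendsto (modulusOfContinuity f) (nhdsWithin 0 (Set.Ioi 0)) (nhds 0) ∧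
    ∀ t : ℝ, 0 < t → 0 < modulusOfExpansion f t

/-- `f` is a coarse embedding: `w_f(t) < ∞` for all `t > 0`, and `ρ_f(t) → ∞` as `t → ∞`. -/
def IsCoarseEmb (f : M → N) : Prop :=
  (∀ t : ℝ, 0 < t → modulusOfContinuity f t < ∞) ∧
    Filter.Tendsto (modulusOfExpansion f) Filter.atTop (nhds ∞)

end Embeddings

section Cotype

variable (X : Type u) [NormedAddCommGroup X]

/-- `X` has (Rademacher) cotype `q`: for some constant `C` and all finite families `x₁, …, xₙ`,
`(∑ ‖xᵢ‖ ^ q) ^ (1/q) ≤ C (E ‖∑ εᵢ xᵢ‖ ^ 2) ^ (1/2)`, the mean being over all choices of signs. -/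
def HasCotype (q : ℝ) : Prop :=
  ∃ C : ℝ, ∀ (n : ℕ) (x : Fin n → X),
    (∑ i, ‖x i‖ ^ q) ^ (1 / q) ≤
      C * Real.sqrt ((∑ ε : Fin n → ℤˣ, ‖∑ i, (ε i : ℤ) • x i‖ ^ 2) / 2 ^ n)

/-- `X` has nontrivial cotype: it has cotype `q` for some `2 ≤ q < ∞`. -/
def HasNontrivialCotype : Prop :=
  ∃ q : ℝ, 2 ≤ q ∧ HasCotype X q

end Cotype

section Linfty

variable (𝕜 : Type v) {X : Type u} [RCLike 𝕜] [NormedAddCommGroup X] [NormedSpace 𝕜 X]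

/-- `u₁, …, uₙ` is `C`-equivalent to the unit vector basis of `ℓ_∞^n`: for some `A, B > 0` with
`B / A ≤ C`, one has `A max |aᵢ| ≤ ‖∑ aᵢ uᵢ‖ ≤ B max |aᵢ|` for all scalars `aᵢ`.
(`Fin n → 𝕜` carries the maximum norm.) -/
def IsLinftyBasis (C : ℝ) {n : ℕ} (u : Fin n → X) : Prop :=
  ∃ A B : ℝ, 0 < A ∧ 0 < B ∧ B ≤ C * A ∧
    ∀ a : Fin n → 𝕜, A * ‖a‖ ≤ ‖∑ i, a i • u i‖ ∧ ‖∑ i, a i • u i‖ ≤ B * ‖a‖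

variable (X) in
/-- `X` contains the spaces `ℓ_∞^n` `C`-uniformly: for every `n` there is a `C`-isomorphic copy
of `ℓ_∞^n` in `X`. -/
def ContainsLinftyUniformly (C : ℝ) : Prop :=
  ∀ n : ℕ, ∃ u : Fin n → X, IsLinftyBasis 𝕜 C u

end Linfty

section LongBases

variable {𝕜 : Type v} {X : Type u} [RCLike 𝕜] [NormedAddCommGroup X] [NormedSpace 𝕜 X]

/-- `S` is the family of partial sums `S α = ∑_{γ < α} x_γ`, `α ≤ Λ`, of the (convergent)
transfinite series `∑_{γ < Λ} x_γ`. Continuity is for the order topology of the ordinals: at a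
limit ordinal, the partial sum is the norm limit of the previous ones. -/
def IsPartialSums {Λ : Ordinal.{w}} (x : Set.Iio Λ → X) (S : Ordinal.{w} → X) : Prop :=
  S 0 = 0 ∧ (∀ γ : Set.Iio Λ, S (Order.succ (γ : Ordinal.{w})) = S γ + x γ) ∧
    ContinuousOn S (Set.Iic Λ)

/-- The transfinite series `∑_{γ < Λ} x_γ` converges to `s`. -/
def HasTransfiniteSum {Λ : Ordinal.{w}} (x : Set.Iio Λ → X) (s : X) : Prop :=
  ∃ S : Ordinal.{w} → X, IsPartialSums x S ∧ S Λ = s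

variable (𝕜) in
/-- `(e_γ)_{γ < Λ}` is a long Schauder basic sequence: every element `x` of its closed linear span
is `x = ∑_{γ < Λ} a_γ e_γ` for a unique family of scalars `(a_γ)_{γ < Λ}`. -/
def IsLongBasicSequence {Λ : Ordinal.{w}} (e : Set.Iio Λ → X) : Prop :=
  ∀ x ∈ (Submodule.span 𝕜 (Set.range e)).topologicalClosure,
    ∃! a : Set.Iio Λ → 𝕜, HasTransfiniteSum (fun γ => a γ • e γ) x

variable (𝕜) in
/-- `(e_γ)_{γ < Λ}` is monotone: the partial sums of a convergent series `∑_{γ < Λ} a_γ e_γ` are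
bounded in norm by its sum. -/
def IsMonotoneSequence {Λ : Ordinal.{w}} (e : Set.Iio Λ → X) : Prop :=
  ∀ (a : Set.Iio Λ → 𝕜) (S : Ordinal.{w} → X), IsPartialSums (fun γ => a γ • e γ) S →
    ∀ α ≤ Λ, ‖S α‖ ≤ ‖S Λ‖

variable (𝕜) in
/-- `(e_γ)_{γ < Λ}` is a normalized monotone long Schauder basic sequence of length `Λ`. -/
structure IsNormalizedMonotoneLongBasic {Λ : Ordinal.{w}} (e : Set.Iio Λ → X) : Prop where
  norm_eq_one : ∀ γ, ‖e γ‖ = 1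
  basic : IsLongBasicSequence 𝕜 e
  monotone : IsMonotoneSequence 𝕜 e

end LongBases

end CoarseC0

end

/-! Both kinds of embedding supply scales `s`, `T`, `L` such that points at distance at most `s`
have images at distance at most `L`, while images at distance at most `8L` come from points at
distance at most `T` (`exists_scales`). Evaluate `f` at the points `(s/2) ∑ εᵢ e_{αᵢ}`, with `αᵢ` in
the `i`-th of rapidly growing blocks of ordinals. Changing one `αᵢ` moves the image by at most `L`.
An element of `c₀(Γ)` is small off a finite set, so after rounding to a grid of mesh `4L` only
countably many functions occur along a line. By cardinality
(`exists_forall_ne_eq_of_countable_lines`), two points differing in every coordinate have equal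
roundings for all signs at once. Hence `‖∑ εᵢ (e_{αᵢ} - e_{βᵢ})‖ ≤ 2T/s` whatever `n` is.
Monotonicity gives the lower `ℓ_∞` estimate.

Almost isometric copies then follow by James' argument, and they rule out cotype. The monotone
sequence itself is built by transfinite recursion: since `ℶ_ω` is a strong limit, norming
functionals for the span of fewer than `ℶ_ω` vectors have a common nonzero kernel vector
(`exists_norm_eq_one_orthogonal`). -/

namespace CoarseC0

/-! ### Coincidences on products of rapidly growing sets, and blocks of beth ordinals -/

section Combinatorics

open Cardinal

/-- A map on a finite product of rapidly growing sets whose restrictions to lines have countable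
image takes the same value at two points all of whose coordinates differ. -/
theorem exists_forall_ne_eq_of_countable_lines {A : ℕ → Type u} {Y : Type v}
    (hA : ∀ n, ℵ₀ ^ #(∀ i : Fin n, A i) < #(A n)) (n : ℕ) (G : (∀ i : Fin n, A i) → Y)
    (hG : ∀ α i, (Set.range fun b => G (Function.update α i b)).Countable) :
    ∃ α β, (∀ i, α i ≠ β i) ∧ G α = G β := by
  induction n with
  | zero => exact ⟨fun i => i.elim0, fun i => i.elim0, fun i => i.elim0, rfl⟩
  | succ n ih =>
    have hne : Nonempty (A n) := mk_ne_zero_iff.1 (pos_of_gt (hA n)).ne'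
    obtain ⟨b₀⟩ := hne
    -- If every pair were separated by some `α`, countable codes of the values would embed `A n`
    -- into `ℕ` to the power of the product of the earlier factors, against `hA n`.
    obtain ⟨b, b', hbb, hb⟩ : ∃ b b' : A n, b ≠ b' ∧ ∀ α : ∀ i : Fin n, A i,
        G (Fin.snoc (α := fun i : Fin (n + 1) => A i) α b) =
          G (Fin.snoc (α := fun i : Fin (n + 1) => A i) α b') := by
      have hcount : ∀ α : ∀ i : Fin n, A i, (Set.range fun b : A n =>
          G (Fin.snoc (α := fun i : Fin (n + 1) => A i) α b)).Countable := by
        intro α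
        have := hG (Fin.snoc (α := fun i : Fin (n + 1) => A i) α b₀) (Fin.last n)
        refine this.mono ?_
        rintro _ ⟨b, rfl⟩
        exact ⟨b, congrArg G (Fin.update_snoc_last ..)⟩
      choose c hc using fun α => Set.countable_iff_exists_injOn.1 (hcount α)
      by_contra! hne
      have hinj : Function.Injective (fun (b : A n) (α : ∀ i : Fin n, A i) =>
          c α (G (Fin.snoc (α := fun i : Fin (n + 1) => A i) α b))) := by
        intro b b' hb
        by_contra hbb
        obtain ⟨p, hp⟩ := hne b b' hbb
        exact hp (hc p ⟨b, rfl⟩ ⟨b', rfl⟩ (congrFun hb p))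
      have hle := mk_le_of_injective hinj
      rw [mk_arrow, mk_nat, lift_aleph0, lift_uzero] at hle
      exact (hle.trans_lt (hA n)).false
    obtain ⟨α, β, hne, heq⟩ := ih
      (fun α => G (Fin.snoc (α := fun i : Fin (n + 1) => A i) α b)) (by
        intro α i
        have := hG (Fin.snoc (α := fun i : Fin (n + 1) => A i) α b) i.castSucc
        refine this.mono ?_
        rintro _ ⟨c, rfl⟩
        exact ⟨c, congrArg G (Fin.snoc_update ..).symm⟩)
    refine ⟨Fin.snoc (α := fun i : Fin (n + 1) => A i) α b,
      Fin.snoc (α := fun i : Fin (n + 1) => A i) β b', fun i => ?_, heq.trans (hb β)⟩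
    induction i using Fin.lastCases with
    | last => simpa only [Fin.snoc_last] using hbb
    | cast i => simpa only [Fin.snoc_castSucc] using hne i

/-- The ordinals between the initial ordinals of `ℶ_{2n}` and `ℶ_{2n+2}`. -/
def bethBlock (n : ℕ) : Set Ordinal.{u} :=
  Set.Ico (beth.{u} (2 * n : ℕ)).ord (beth.{u} (2 * n + 2 : ℕ)).ord

theorem lt_of_mem_bethBlock {m n : ℕ} (h : m < n) {x y : Ordinal.{u}} (hx : x ∈ bethBlock m)
    (hy : y ∈ bethBlock n) : x < y := by
  refine hx.2.trans_le (le_trans (ord_le_ord.2 (beth_strictMono.monotone ?_)) hy.1)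
  exact_mod_cast (by omega : 2 * m + 2 ≤ 2 * n)

theorem lt_of_mem_bethBlock_omega {n : ℕ} {x : Ordinal.{u}} (hx : x ∈ bethBlock n) :
    x < (beth.{u} Ordinal.omega0).ord :=
  hx.2.trans (ord_lt_ord.2 (beth_strictMono (Ordinal.natCast_lt_omega0 _)))

theorem mk_Iio_beth_ord (m : ℕ) :
    #(Set.Iio (beth.{u} m).ord) = beth.{u + 1} m := by
  rw [mk_Iio_ordinal, card_ord]
  induction m with
  | zero => simp
  | succ m ih =>
    rw [Nat.cast_succ, Nat.cast_succ, ← Order.succ_eq_add_one, ← Order.succ_eq_add_one, beth_succ,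
      beth_succ, lift_two_power, ih]

/-- The two beth steps per block serve here: the earlier blocks have product at most `ℶ_{2n}`,
exponentiation costs one step, to `ℶ_{2n+1}`, and the second step makes the inequality strict. -/
theorem aleph0_power_pi_bethBlock_lt (n : ℕ) :
    ℵ₀ ^ #(∀ i : Fin n, bethBlock.{u} i) < #(bethBlock.{u} n) := by
  have h1 : #(∀ i : Fin n, bethBlock.{u} i) ≤ beth.{u + 1} (2 * n : ℕ) := by
    have : Function.Injective (fun (α : ∀ i : Fin n, bethBlock.{u} i) (i : Fin n) =>
        (⟨(α i : Ordinal.{u}), by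
          refine (α i).2.2.trans_le (ord_le_ord.2 (beth_strictMono.monotone ?_))
          have := i.2
          exact_mod_cast (by omega : 2 * (i : ℕ) + 2 ≤ 2 * n)⟩ :
          Set.Iio (beth.{u} (2 * n : ℕ)).ord)) := by
      intro α β h
      funext i
      exact Subtype.ext (congrArg (fun z : Set.Iio _ => (z : Ordinal.{u})) (congrFun h i))
    refine (mk_le_of_injective this).trans ?_
    rw [mk_arrow, mk_Iio_beth_ord]
    simpa using power_nat_le (n := n) (aleph0_le_beth.{u + 1} (2 * n : ℕ))
  have h2 : ℵ₀ ^ #(∀ i : Fin n, bethBlock.{u} i) ≤ beth.{u + 1} (2 * n + 1 : ℕ) := by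
    refine (power_le_power_left aleph0_ne_zero h1).trans ?_
    refine (power_le_power_right (aleph0_le_beth (2 * n : ℕ))).trans ?_
    rw [power_self_eq (aleph0_le_beth _), ← beth_succ, Order.succ_eq_add_one, Nat.cast_succ]
  refine h2.trans_lt ?_
  by_contra! h3
  have h4 : #(Set.Iio (beth.{u} (2 * n + 2 : ℕ)).ord) ≤
      beth.{u + 1} (2 * n + 1 : ℕ) + beth.{u + 1} (2 * n + 1 : ℕ) := by
    have hsub : Set.Iio (beth.{u} (2 * n + 2 : ℕ)).ord ⊆
        Set.Iio (beth.{u} (2 * n : ℕ)).ord ∪ bethBlock n := by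
      intro x hx
      by_cases h : x < (beth.{u} (2 * n : ℕ)).ord
      · exact Or.inl h
      · exact Or.inr ⟨not_lt.1 h, hx⟩
    refine (mk_le_mk_of_subset hsub).trans ((mk_union_le _ _).trans (add_le_add ?_ h3))
    rw [mk_Iio_beth_ord]
    exact beth_strictMono.monotone (by exact_mod_cast (by omega : 2 * n ≤ 2 * n + 1))
  rw [add_eq_self (aleph0_le_beth _), mk_Iio_beth_ord] at h4
  exact absurd h4 (not_le.2 (beth_strictMono (by exact_mod_cast Nat.lt_succ_self _)))

end Combinatorics

/-! ### Finite `ℓ_∞` systems: signs versus scalars, James' argument, cotype -/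

section LinftyBases

variable {𝕜 : Type v} {X : Type u} [RCLike 𝕜] [NormedAddCommGroup X] [NormedSpace 𝕜 X]

/-- An upper `ℓ_∞`-estimate for all choices of signs gives one for all scalars. -/
theorem norm_sum_smul_le_of_signs {n : ℕ} (x : Fin n → X) {M : ℝ}
    (hM : ∀ ε : Fin n → ℤˣ, ‖∑ i, (ε i : ℤ) • x i‖ ≤ M) (a : Fin n → 𝕜) :
    ‖∑ i, a i • x i‖ ≤ 2 * M * ‖a‖ := by
  obtain ⟨g, hg, hgx⟩ := exists_dual_vector'' 𝕜 (∑ i, a i • x i)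
  -- Signs matching those of `r` turn the sum into `∑ |r i|`. Real and imaginary parts of `g (x i)`
  -- are treated separately, whence the factor `2`.
  have key : ∀ r : Fin n → ℝ, (∀ ε : Fin n → ℤˣ,
      ∑ i, ((ε i : ℤ) : ℝ) * r i ≤ ‖g (∑ i, (ε i : ℤ) • x i)‖) → ∑ i, |r i| ≤ M := by
    intro r hr
    have h := hr fun i => if 0 ≤ r i then 1 else -1
    have h2 : ∑ i, |r i| = ∑ i, (((if 0 ≤ r i then 1 else -1 : ℤˣ) : ℤ) : ℝ) * r i := by
      refine Finset.sum_congr rfl fun i _ => ?_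
      split_ifs with h0
      · simp [abs_of_nonneg h0]
      · simp [abs_of_neg (not_le.1 h0)]
    rw [h2]
    refine h.trans ((g.le_opNorm _).trans ?_)
    exact (mul_le_of_le_one_left (norm_nonneg _) hg).trans (hM _)
  have hre : ∑ i, |RCLike.re (g (x i))| ≤ M := key _ fun ε => by
    refine le_trans (le_of_eq ?_) (RCLike.re_le_norm _)
    simp [map_sum, ← Int.cast_smul_eq_zsmul ℝ, RCLike.smul_re]
  have him : ∑ i, |RCLike.im (g (x i))| ≤ M := key _ fun ε => by
    refine le_trans (le_of_eq ?_) (RCLike.im_le_norm _)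
    simp [map_sum, ← Int.cast_smul_eq_zsmul ℝ, RCLike.smul_im]
  have h1 : ‖∑ i, a i • x i‖ = ‖g (∑ i, a i • x i)‖ := by simp [hgx]
  calc ‖∑ i, a i • x i‖ = ‖∑ i, a i * g (x i)‖ := by rw [h1]; simp [map_sum]
    _ ≤ ∑ i, ‖a i * g (x i)‖ := norm_sum_le _ _
    _ ≤ ∑ i, ‖a‖ * (|RCLike.re (g (x i))| + |RCLike.im (g (x i))|) := by
        refine Finset.sum_le_sum fun i _ => ?_
        rw [norm_mul]
        refine mul_le_mul (norm_le_pi_norm a i) ?_ (norm_nonneg _) (norm_nonneg _)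
        conv_lhs => rw [← RCLike.re_add_im (g (x i))]
        refine (norm_add_le _ _).trans (add_le_add (RCLike.norm_ofReal _).le ?_)
        rw [norm_mul, RCLike.norm_ofReal]
        exact mul_le_of_le_one_right (abs_nonneg _) (by rw [RCLike.norm_I]; split_ifs <;> simp)
    _ = ‖a‖ * (∑ i, |RCLike.re (g (x i))| + ∑ i, |RCLike.im (g (x i))|) := by
        rw [← Finset.mul_sum, Finset.sum_add_distrib]
    _ ≤ ‖a‖ * (M + M) := by gcongr
    _ = 2 * M * ‖a‖ := by ring

/-- James' blocking argument, by induction on the number `K` of times the upper constant can shrink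
by the factor `1 - δ` while staying above `A`. -/
theorem exists_isLinftyBasis_of_pow_mul_lt {δ C : ℝ} (hδ : 0 < δ) (hδ2 : δ < 1 / 2)
    (hC : 1 ≤ C * (1 - 2 * δ)) (n : ℕ) (K : ℕ) :
    ∃ N : ℕ, ∀ (A B : ℝ) (x : Fin N → X), 0 < A → 0 < B → (1 - δ) ^ K * B < A →
      (∀ a : Fin N → 𝕜, A * ‖a‖ ≤ ‖∑ i, a i • x i‖ ∧ ‖∑ i, a i • x i‖ ≤ B * ‖a‖) →
      ∃ y : Fin n → X, IsLinftyBasis 𝕜 C y := by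
  rcases Nat.eq_zero_or_pos n with rfl | hn
  · refine ⟨0, fun A B x _ _ _ _ => ⟨fun i => i.elim0, 1, 1, one_pos, one_pos, ?_, fun a => ?_⟩⟩
    · by_contra! h
      nlinarith
    · simp [Subsingleton.elim a 0]
  induction K with
  | zero =>
    refine ⟨1, fun A B x hA hB hAB h => ?_⟩
    have := h fun _ => 1
    simp only [pow_zero, one_mul] at hAB
    have h1 : ‖(fun _ : Fin 1 => (1 : 𝕜))‖ = 1 := by simp
    rw [h1] at this
    linarith [this.1, this.2]
  | succ K ih =>
    obtain ⟨N, hN⟩ := ih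
    refine ⟨n * N, fun A B x hA hB hAB h => ?_⟩
    have hblock : ∀ b : Fin n → Fin N → 𝕜,
        ∑ k, (fun k => b (finProdFinEquiv.symm k).1 (finProdFinEquiv.symm k).2) k • x k =
          ∑ i, ∑ j, b i j • x (finProdFinEquiv (i, j)) := by
      intro b
      rw [← Equiv.sum_comp finProdFinEquiv, Fintype.sum_prod_type]
      simp
    -- Split into `n` blocks of length `N`. Either some block has the smaller upper constant `(1 -
    -- δ) B`, and induction applies to it, or each block carries a vector nearly attaining `B`, and
    -- these vectors form the required system.
    by_cases hcase : ∃ i : Fin n, ∀ a : Fin N → 𝕜,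
        ‖∑ j, a j • x (finProdFinEquiv (i, j))‖ ≤ (1 - δ) * B * ‖a‖
    · obtain ⟨i, hi⟩ := hcase
      refine hN A ((1 - δ) * B) (fun j => x (finProdFinEquiv (i, j))) hA
        (mul_pos (by linarith) hB) (by rw [← mul_assoc, ← pow_succ]; exact hAB)
        fun a => ⟨?_, hi a⟩
      have h1 := (h fun k => (Pi.single i a : Fin n → Fin N → 𝕜) (finProdFinEquiv.symm k).1
        (finProdFinEquiv.symm k).2).1
      rw [hblock, Finset.sum_eq_single i (fun i' _ hi' => by simp [hi']) (by simp)] at h1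
      simp only [Pi.single_eq_same] at h1
      refine le_trans (mul_le_mul_of_nonneg_left ?_ hA.le) h1
      refine (pi_norm_le_iff_of_nonneg (norm_nonneg _)).2 fun j => ?_
      have := norm_le_pi_norm (fun k => (Pi.single i a : Fin n → Fin N → 𝕜)
        (finProdFinEquiv.symm k).1 (finProdFinEquiv.symm k).2) (finProdFinEquiv (i, j))
      simpa using this
    · push Not at hcase
      choose a ha using hcase
      have ha0 : ∀ i, ‖a i‖ ≠ 0 := by
        intro i h0
        have h1 := ha i
        rw [h0, norm_eq_zero.1 h0] at h1
        simp at h1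
      set v : Fin n → X := fun i => ((‖a i‖⁻¹ : ℝ) : 𝕜) • ∑ j, a i j • x (finProdFinEquiv (i, j))
        with hv
      have hvn : ∀ i, (1 - δ) * B ≤ ‖v i‖ := by
        intro i
        rw [hv]
        simp only [norm_smul, RCLike.norm_ofReal, abs_inv, abs_norm]
        rw [inv_mul_eq_div, le_div_iff₀ (lt_of_le_of_ne (norm_nonneg _) (ha0 i).symm)]
        exact (ha i).le
      have hup : ∀ b : Fin n → 𝕜, ‖∑ i, b i • v i‖ ≤ B * ‖b‖ := by
        intro b
        have h1 := (h fun k => (fun i j => b i * (((‖a i‖⁻¹ : ℝ) : 𝕜) * a i j) :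
          Fin n → Fin N → 𝕜) (finProdFinEquiv.symm k).1 (finProdFinEquiv.symm k).2).2
        have h2 : ∑ i, b i • v i = ∑ i, ∑ j, (b i * (((‖a i‖⁻¹ : ℝ) : 𝕜) * a i j)) •
            x (finProdFinEquiv (i, j)) := by
          refine Finset.sum_congr rfl fun i _ => ?_
          simp only [hv, mul_smul, Finset.smul_sum]
        rw [h2, ← hblock fun i j => b i * (((‖a i‖⁻¹ : ℝ) : 𝕜) * a i j)]
        refine h1.trans (mul_le_mul_of_nonneg_left ?_ hB.le)
        refine (pi_norm_le_iff_of_nonneg (norm_nonneg _)).2 fun k => ?_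
        simp only [norm_mul, RCLike.norm_ofReal, abs_inv, abs_norm]
        refine le_trans ?_ (norm_le_pi_norm b (finProdFinEquiv.symm k).1)
        refine mul_le_of_le_one_right (norm_nonneg _) ?_
        rw [inv_mul_eq_div]
        exact div_le_one_of_le₀ (norm_le_pi_norm (a _) _) (norm_nonneg _)
      refine ⟨v, (1 - 2 * δ) * B, B, mul_pos (by linarith) hB, hB, by nlinarith,
        fun b => ⟨?_, hup b⟩⟩
      have : Nonempty (Fin n) := ⟨⟨0, hn⟩⟩
      obtain ⟨i₀, hi₀⟩ : ∃ i, ‖b i‖ = ‖b‖ := by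
        obtain ⟨i, -, hi⟩ := Finset.exists_max_image Finset.univ (fun i => ‖b i‖)
          Finset.univ_nonempty
        exact ⟨i, le_antisymm (norm_le_pi_norm b i)
          ((pi_norm_le_iff_of_nonneg (norm_nonneg _)).2 fun j => hi j (Finset.mem_univ _))⟩
      -- Flipping all signs but the one at a maximal coordinate leaves `2 b i₀ • v i₀` in the sum of
      -- the two combinations. This yields the lower constant `2 (1 - δ) B - B = (1 - 2δ) B`.
      set b' : Fin n → 𝕜 := fun i => if i = i₀ then b i else -b i with hb'
      have hb'n : ‖b'‖ ≤ ‖b‖ := by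
        refine (pi_norm_le_iff_of_nonneg (norm_nonneg _)).2 fun i => ?_
        have := norm_le_pi_norm b i
        simp only [hb']
        split_ifs <;> simpa using this
      have hsum : (2 * b i₀) • v i₀ = ∑ i, b i • v i + ∑ i, b' i • v i := by
        rw [← Finset.sum_add_distrib, Finset.sum_eq_single i₀]
        · simp [hb', two_mul, add_smul]
        · intro i _ hi
          simp [hb', hi]
        · simp
      have h1 : 2 * ‖b‖ * ((1 - δ) * B) ≤ ‖∑ i, b i • v i‖ + B * ‖b‖ := by
        calc 2 * ‖b‖ * ((1 - δ) * B) ≤ 2 * ‖b‖ * ‖v i₀‖ := by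
              gcongr
              exact hvn i₀
          _ = ‖(2 * b i₀) • v i₀‖ := by simp [norm_smul, hi₀]
          _ ≤ ‖∑ i, b i • v i‖ + ‖∑ i, b' i • v i‖ := by rw [hsum]; exact norm_add_le _ _
          _ ≤ _ := by
              gcongr
              exact (hup b').trans (mul_le_mul_of_nonneg_left hb'n hB.le)
      linarith

/-- James: a space containing the `ℓ_∞^n` uniformly contains them almost isometrically. -/
theorem ContainsLinftyUniformly.of_one_lt {C₀ : ℝ} (h : ContainsLinftyUniformly 𝕜 X C₀) {C : ℝ}
    (hC : 1 < C) : ContainsLinftyUniformly 𝕜 X C := by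
  intro n
  have hC0 : 0 < C := by linarith
  have hCinv : C⁻¹ < 1 := inv_lt_one_of_one_lt₀ hC
  have hCpos : 0 < C⁻¹ := inv_pos.2 hC0
  obtain ⟨K, hK⟩ := exists_pow_lt_of_lt_one (show 0 < (|C₀| + 1)⁻¹ by positivity)
    (show 1 - (1 - C⁻¹) / 2 < 1 by linarith)
  -- This `δ` makes `1 - 2δ` equal to `C⁻¹`.
  obtain ⟨N, hN⟩ := exists_isLinftyBasis_of_pow_mul_lt (𝕜 := 𝕜) (X := X)
    (δ := (1 - C⁻¹) / 2) (C := C) (by linarith) (by linarith)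
    (by rw [show 1 - 2 * ((1 - C⁻¹) / 2) = C⁻¹ by ring, mul_inv_cancel₀ hC0.ne']) n K
  obtain ⟨x, A, B, hA, hB, hBA, hx⟩ := h N
  refine hN A B x hA hB ?_ hx
  have h1 : B < (|C₀| + 1) * A := by nlinarith [le_abs_self C₀]
  calc _ < (|C₀| + 1)⁻¹ * B := mul_lt_mul_of_pos_right hK hB
    _ ≤ A := by rw [inv_mul_le_iff₀ (by positivity)]; exact h1.le

/-- On a copy of `ℓ_∞^n` every signed sum has norm at most `B ≤ C A`, while the left side of the
cotype inequality is at least `n ^ (1/q) * A`, which is unbounded after division by `A`. -/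
theorem ContainsLinftyUniformly.not_hasNontrivialCotype {C : ℝ}
    (h : ContainsLinftyUniformly 𝕜 X C) : ¬ HasNontrivialCotype X := by
  rintro ⟨q, hq, D, hD⟩
  have hq0 : 0 < q := by linarith
  obtain ⟨n, hn⟩ : ∃ n : ℕ, |D| * |C| < (n : ℝ) ^ (1 / q) :=
    (((tendsto_rpow_atTop (one_div_pos.2 hq0)).comp tendsto_natCast_atTop_atTop).eventually_gt_atTop
      (|D| * |C|)).exists
  obtain ⟨x, A, B, hA, hB, hBA, hx⟩ := h n
  have h1 : (n : ℝ) ^ (1 / q) * A ≤ (∑ i, ‖x i‖ ^ q) ^ (1 / q) := by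
    have h2 : ∀ i, A ≤ ‖x i‖ := by
      intro i
      have h3 := (hx (Pi.single i 1)).1
      rw [Finset.sum_eq_single i (fun j _ hj => by simp [hj]) (by simp)] at h3
      simpa [Pi.norm_single] using h3
    calc (n : ℝ) ^ (1 / q) * A = (∑ _i : Fin n, A ^ q) ^ (1 / q) := by
          rw [Finset.sum_const, Finset.card_univ, Fintype.card_fin, nsmul_eq_mul,
            Real.mul_rpow (by positivity) (by positivity), one_div, Real.rpow_rpow_inv hA.le hq0.ne']
      _ ≤ _ := by
          refine Real.rpow_le_rpow (Finset.sum_nonneg fun i _ => by positivity) ?_ (by positivity)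
          exact Finset.sum_le_sum fun i _ => Real.rpow_le_rpow hA.le (h2 i) hq0.le
  have h4 : Real.sqrt ((∑ ε : Fin n → ℤˣ, ‖∑ i, (ε i : ℤ) • x i‖ ^ 2) / 2 ^ n) ≤ B := by
    refine Real.sqrt_le_iff.2 ⟨hB.le, ?_⟩
    rw [div_le_iff₀ (by positivity)]
    have h5 : ∀ ε : Fin n → ℤˣ, ‖∑ i, (ε i : ℤ) • x i‖ ≤ B := by
      intro ε
      have h6 := (hx fun i => ((ε i : ℤ) : 𝕜)).2
      simp only [Int.cast_smul_eq_zsmul] at h6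
      refine h6.trans (mul_le_of_le_one_right hB.le ?_)
      refine (pi_norm_le_iff_of_nonneg zero_le_one).2 fun i => ?_
      rcases Int.units_eq_one_or (ε i) with h | h <;> simp [h]
    calc ∑ ε : Fin n → ℤˣ, ‖∑ i, (ε i : ℤ) • x i‖ ^ 2 ≤ ∑ _ε : Fin n → ℤˣ, B ^ 2 :=
          Finset.sum_le_sum fun ε _ => pow_le_pow_left₀ (norm_nonneg _) (h5 ε) 2
      _ = B ^ 2 * 2 ^ n := by
          simp [mul_comm]
  have h7 := (h1.trans (hD n x)).trans
    ((mul_le_mul_of_nonneg_right (le_abs_self D) (Real.sqrt_nonneg _)).trans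
      (mul_le_mul_of_nonneg_left h4 (abs_nonneg D)))
  have h8 : |D| * B ≤ |D| * (|C| * A) := by
    gcongr
    exact hBA.trans (mul_le_mul_of_nonneg_right (le_abs_self C) hA.le)
  nlinarith

end LinftyBases

/-! ### Transfinite partial sums, and monotone sequences as long bases -/

section PartialSums

open Topology Filter

variable {𝕜 : Type v} {X : Type u} [RCLike 𝕜] [NormedAddCommGroup X] [NormedSpace 𝕜 X]
  {Λ : Ordinal.{w}}

/-- The partial sums of the transfinite series with the finitely many nonzero terms
`c γ • e γ`. -/
noncomputable def finsuppPartialSum (e : Set.Iio Λ → X) (c : Set.Iio Λ →₀ 𝕜) (α : Ordinal.{w}) : X :=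
  ∑ γ ∈ c.support, if (γ : Ordinal.{w}) < α then c γ • e γ else 0

theorem continuous_finsuppPartialSum (e : Set.Iio Λ → X) (c : Set.Iio Λ →₀ 𝕜) :
    Continuous (finsuppPartialSum e c) := by
  refine continuous_finsetSum _ fun γ _ => ?_
  -- Each indicator is continuous because `(γ, ∞) = [γ + 1, ∞)` is clopen in the ordinals.
  have hclopen : IsClopen {α : Ordinal.{w} | (γ : Ordinal.{w}) < α} := by
    refine ⟨?_, isOpen_Ioi⟩
    have : {α : Ordinal.{w} | (γ : Ordinal.{w}) < α} = Set.Ici (Order.succ (γ : Ordinal.{w})) := by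
      ext α
      simp
    rw [this]
    exact isClosed_Ici
  refine Continuous.if (fun α hα => ?_) continuous_const continuous_const
  rw [hclopen.frontier_eq] at hα
  exact hα.elim

theorem finsuppPartialSum_eq_sum (e : Set.Iio Λ → X) (c : Set.Iio Λ →₀ 𝕜)
    {s : Finset (Set.Iio Λ)} (hs : c.support ⊆ s) (α : Ordinal.{w}) :
    finsuppPartialSum e c α = ∑ γ ∈ s, if (γ : Ordinal.{w}) < α then c γ • e γ else 0 := by
  refine Finset.sum_subset hs fun γ _ hγ => ?_
  rw [Finsupp.notMem_support_iff.1 hγ]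
  simp

theorem finsuppPartialSum_sub (e : Set.Iio Λ → X) (c d : Set.Iio Λ →₀ 𝕜) (α : Ordinal.{w}) :
    finsuppPartialSum e (c - d) α = finsuppPartialSum e c α - finsuppPartialSum e d α := by
  classical
  rw [finsuppPartialSum_eq_sum e (c - d) (s := c.support ∪ d.support) Finsupp.support_sub,
    finsuppPartialSum_eq_sum e c Finset.subset_union_left,
    finsuppPartialSum_eq_sum e d Finset.subset_union_right, ← Finset.sum_sub_distrib]
  refine Finset.sum_congr rfl fun γ _ => ?_
  split_ifs <;> simp [sub_smul]

theorem finsuppPartialSum_of_le (e : Set.Iio Λ → X) (c : Set.Iio Λ →₀ 𝕜) {α : Ordinal.{w}}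
    (hα : Λ ≤ α) : finsuppPartialSum e c α = Finsupp.linearCombination 𝕜 e c := by
  rw [Finsupp.linearCombination_apply, Finsupp.sum]
  exact Finset.sum_congr rfl fun γ _ => if_pos (γ.2.trans_le hα)

theorem finsuppPartialSum_zero (e : Set.Iio Λ → X) (c : Set.Iio Λ →₀ 𝕜) :
    finsuppPartialSum e c 0 = 0 :=
  Finset.sum_eq_zero fun _ _ => if_neg (not_lt.2 (zero_le))

theorem finsuppPartialSum_succ (e : Set.Iio Λ → X) (c : Set.Iio Λ →₀ 𝕜) (γ : Set.Iio Λ) :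
    finsuppPartialSum e c (Order.succ (γ : Ordinal.{w})) =
      finsuppPartialSum e c γ + c γ • e γ := by
  classical
  have hs : c.support ⊆ insert γ c.support := Finset.subset_insert _ _
  rw [finsuppPartialSum_eq_sum e c hs, finsuppPartialSum_eq_sum e c hs]
  have h : c γ • e γ = ∑ δ ∈ insert γ c.support, if δ = γ then c δ • e δ else 0 := by
    rw [Finset.sum_ite_eq' _ γ, if_pos (Finset.mem_insert_self _ _)]
  rw [h, ← Finset.sum_add_distrib]
  refine Finset.sum_congr rfl fun δ _ => ?_
  simp only [Order.lt_succ_iff]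
  rcases lt_trichotomy δ γ with hlt | rfl | hlt
  · rw [if_pos (Subtype.coe_le_coe.2 hlt.le), if_pos (Subtype.coe_lt_coe.2 hlt), if_neg hlt.ne,
      add_zero]
  · simp
  · rw [if_neg (not_le.2 (Subtype.coe_lt_coe.2 hlt)), if_neg (not_lt.2 (Subtype.coe_le_coe.2 hlt.le)),
      if_neg hlt.ne', add_zero]

theorem isPartialSums_finsuppPartialSum (e : Set.Iio Λ → X) (c : Set.Iio Λ →₀ 𝕜) :
    IsPartialSums (fun γ => c γ • e γ) (finsuppPartialSum e c) :=
  ⟨finsuppPartialSum_zero e c, finsuppPartialSum_succ e c,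
    (continuous_finsuppPartialSum e c).continuousOn⟩

/-- In a normalized monotone sequence the coordinate functionals have norm at most `2`. -/
theorem IsMonotoneSequence.norm_coeff_le {e : Set.Iio Λ → X} (he : IsMonotoneSequence 𝕜 e)
    (hn : ∀ γ, ‖e γ‖ = 1) (c : Set.Iio Λ →₀ 𝕜) (γ : Set.Iio Λ) :
    ‖c γ‖ ≤ 2 * ‖Finsupp.linearCombination 𝕜 e c‖ := by
  have hm := he c _ (isPartialSums_finsuppPartialSum e c)
  rw [finsuppPartialSum_of_le e c le_rfl] at hm
  have h1 := finsuppPartialSum_succ e c γ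
  have h2 : c γ • e γ = finsuppPartialSum e c (Order.succ (γ : Ordinal.{w})) -
      finsuppPartialSum e c γ := by rw [h1]; abel
  have h3 : ‖c γ‖ = ‖c γ • e γ‖ := by rw [norm_smul, hn, mul_one]
  rw [h3, h2, two_mul]
  exact (norm_sub_le _ _).trans (add_le_add (hm _ (Order.succ_le_of_lt γ.2)) (hm _ γ.2.le))

/-- Each `e γ` is Birkhoff–James orthogonal to the span of its predecessors. -/
def IsOrthogonalToPredecessors (𝕜 : Type v) [RCLike 𝕜] [NormedSpace 𝕜 X]
    (e : Set.Iio Λ → X) : Prop :=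
  ∀ γ, ∀ x ∈ Submodule.span 𝕜 (e '' Set.Iio γ), ∀ t : 𝕜, ‖x‖ ≤ ‖x + t • e γ‖

theorem IsPartialSums.mem_closure_span {e : Set.Iio Λ → X} {a : Set.Iio Λ → 𝕜}
    {S : Ordinal.{w} → X} (hS : IsPartialSums (fun γ => a γ • e γ) S) {β : Ordinal.{w}}
    (hβ : β ≤ Λ) :
    S β ∈ (Submodule.span 𝕜 (e '' {γ | (γ : Ordinal.{w}) < β})).topologicalClosure := by
  induction β using Ordinal.limitRecOn with
  | zero => rw [hS.1]; exact zero_mem _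
  | add_one β ih =>
    rw [← Order.succ_eq_add_one] at hβ ⊢
    have hβ' : β < Λ := Order.succ_le_iff.1 hβ
    have h1 : S (Order.succ β) = S β + a ⟨β, hβ'⟩ • e ⟨β, hβ'⟩ := hS.2.1 ⟨β, hβ'⟩
    rw [h1]
    refine add_mem ?_ (Submodule.smul_mem _ _ (Submodule.le_topologicalClosure _
      (Submodule.subset_span ⟨_, Order.lt_succ β, rfl⟩)))
    refine Submodule.topologicalClosure_mono (Submodule.span_mono (Set.image_mono ?_))
      (ih hβ'.le)
    exact fun γ (hγ : (γ : Ordinal.{w}) < β) => hγ.trans (Order.lt_succ β)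
  | limit β hlim ih =>
    have hcont : Tendsto S (𝓝[<] β) (𝓝 (S β)) :=
      (hS.2.2 β hβ).mono_left (nhdsWithin_mono _ fun γ hγ => le_trans (le_of_lt hγ) hβ)
    have hne : (𝓝[<] β).NeBot := hlim.isLUB_Iio.nhdsWithin_neBot ⟨0, hlim.bot_lt⟩
    refine (Submodule.isClosed_topologicalClosure _).mem_of_tendsto hcont ?_
    filter_upwards [self_mem_nhdsWithin] with γ hγ
    refine Submodule.topologicalClosure_mono (Submodule.span_mono (Set.image_mono ?_))
      (ih γ hγ (le_trans (le_of_lt hγ) hβ))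
    exact fun δ (hδ : (δ : Ordinal.{w}) < γ) => hδ.trans hγ

/-- Induction on `β`: successors use orthogonality, extended by continuity to the closed span that
contains `S β`; limits use continuity of `S`. -/
theorem IsOrthogonalToPredecessors.norm_le {e : Set.Iio Λ → X}
    (he : IsOrthogonalToPredecessors 𝕜 e) {a : Set.Iio Λ → 𝕜}
    {S : Ordinal.{w} → X} (hS : IsPartialSums (fun γ => a γ • e γ) S) {α β : Ordinal.{w}}
    (hαβ : α ≤ β) (hβ : β ≤ Λ) : ‖S α‖ ≤ ‖S β‖ := by
  induction β using Ordinal.limitRecOn with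
  | zero => rw [le_antisymm hαβ (zero_le)]
  | add_one β ih =>
    rw [← Order.succ_eq_add_one] at hβ hαβ ⊢
    have hβ' : β < Λ := Order.succ_le_iff.1 hβ
    rcases hαβ.eq_or_lt with rfl | hlt
    · exact le_rfl
    refine (ih (Order.lt_succ_iff.1 hlt) hβ'.le).trans ?_
    have h1 : S (Order.succ β) = S β + a ⟨β, hβ'⟩ • e ⟨β, hβ'⟩ := hS.2.1 ⟨β, hβ'⟩
    rw [h1]
    have hcl : IsClosed {x : X | ‖x‖ ≤ ‖x + a ⟨β, hβ'⟩ • e ⟨β, hβ'⟩‖} :=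
      isClosed_le continuous_norm (continuous_id.add continuous_const).norm
    have hmem := hS.mem_closure_span hβ'.le
    rw [← SetLike.mem_coe, Submodule.topologicalClosure_coe] at hmem
    refine closure_minimal (fun x hx => ?_) hcl hmem
    refine he ⟨β, hβ'⟩ x ?_ _
    exact hx
  | limit β hlim ih =>
    rcases hαβ.eq_or_lt with rfl | hlt
    · exact le_rfl
    have hcont : Tendsto S (𝓝[<] β) (𝓝 (S β)) :=
      (hS.2.2 β hβ).mono_left (nhdsWithin_mono _ fun γ hγ => le_trans (le_of_lt hγ) hβ)
    have hne : (𝓝[<] β).NeBot := hlim.isLUB_Iio.nhdsWithin_neBot ⟨0, hlim.bot_lt⟩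
    refine ge_of_tendsto hcont.norm ?_
    filter_upwards [Ioo_mem_nhdsLT hlt] with γ hγ
    exact ih γ hγ.2 hγ.1.le (hγ.2.le.trans hβ)

theorem IsOrthogonalToPredecessors.isMonotoneSequence {e : Set.Iio Λ → X}
    (he : IsOrthogonalToPredecessors 𝕜 e) : IsMonotoneSequence 𝕜 e :=
  fun _ _ hS _ hα => he.norm_le hS hα le_rfl

/-- For finite combinations tending to `x`, monotonicity makes the partial sums Cauchy uniformly in
`α`, so their limit is still continuous in `α`; the coefficients converge by `norm_coeff_le`. -/
theorem IsMonotoneSequence.exists_hasTransfiniteSum [CompleteSpace X] {e : Set.Iio Λ → X}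
    (he : IsMonotoneSequence 𝕜 e) (hn : ∀ γ, ‖e γ‖ = 1) {x : X}
    (hx : x ∈ (Submodule.span 𝕜 (Set.range e)).topologicalClosure) :
    ∃ a : Set.Iio Λ → 𝕜, HasTransfiniteSum (fun γ => a γ • e γ) x := by
  rw [← SetLike.mem_coe, Submodule.topologicalClosure_coe, mem_closure_iff_seq_limit] at hx
  obtain ⟨y, hy, hyx⟩ := hx
  choose c hc using fun n => (Finsupp.mem_span_range_iff_exists_finsupp.1 (hy n))
  have hc' : ∀ n, Finsupp.linearCombination 𝕜 e (c n) = y n := hc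
  have hle : ∀ m n α, ‖finsuppPartialSum e (c m) α - finsuppPartialSum e (c n) α‖ ≤
      ‖y m - y n‖ := by
    intro m n α
    rw [← finsuppPartialSum_sub, ← hc', ← hc', ← map_sub]
    have hm := he _ _ (isPartialSums_finsuppPartialSum e (c m - c n))
    rw [finsuppPartialSum_of_le e (c m - c n) le_rfl] at hm
    rcases le_total α Λ with h | h
    · exact hm α h
    · rw [finsuppPartialSum_of_le e _ h]
  have hcoeff : ∀ m n γ, ‖c m γ - c n γ‖ ≤ 2 * ‖y m - y n‖ := by
    intro m n γ
    rw [← hc', ← hc', ← map_sub]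
    exact he.norm_coeff_le hn (c m - c n) γ
  have hyC := hyx.cauchySeq
  have hunif : UniformCauchySeqOn (fun n => finsuppPartialSum e (c n)) atTop Set.univ := by
    rw [Metric.uniformCauchySeqOn_iff]
    intro ε hε
    obtain ⟨N, hN⟩ := Metric.cauchySeq_iff.1 hyC ε hε
    refine ⟨N, fun m hm n hn α _ => ?_⟩
    have := hN m hm n hn
    rw [dist_eq_norm] at this ⊢
    exact (hle m n α).trans_lt this
  have hlim : ∀ α, ∃ s, Tendsto (fun n => finsuppPartialSum e (c n) α) atTop (𝓝 s) := fun α =>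
    cauchySeq_tendsto_of_complete (hunif.cauchySeq (Set.mem_univ α))
  choose S hS using hlim
  have hlima : ∀ γ, ∃ t, Tendsto (fun n => c n γ) atTop (𝓝 t) := by
    intro γ
    refine cauchySeq_tendsto_of_complete (Metric.cauchySeq_iff.2 fun ε hε => ?_)
    obtain ⟨N, hN⟩ := Metric.cauchySeq_iff.1 hyC (ε / 2) (half_pos hε)
    refine ⟨N, fun m hm n hn => ?_⟩
    have := hN m hm n hn
    rw [dist_eq_norm] at this ⊢
    linarith [hcoeff m n γ]
  choose a ha using hlima
  refine ⟨a, S, ⟨?_, fun γ => ?_, ?_⟩, ?_⟩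
  · refine tendsto_nhds_unique (hS 0) ?_
    simp [finsuppPartialSum_zero]
  · refine tendsto_nhds_unique (hS _) ?_
    simp only [finsuppPartialSum_succ]
    exact (hS _).add ((ha γ).smul_const _)
  · have := hunif.tendstoUniformlyOn_of_tendsto fun α _ => hS α
    refine (this.continuousOn ?_).mono (Set.subset_univ _)
    exact (Eventually.of_forall fun n =>
      (continuous_finsuppPartialSum e (c n)).continuousOn).frequently
  · refine tendsto_nhds_unique (hS Λ) ?_
    simpa only [finsuppPartialSum_of_le e _ le_rfl, hc'] using hyx

/-- The difference of two expansions has total sum `0`, so by monotonicity all its partial sums, and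
hence its terms, vanish. -/
theorem IsMonotoneSequence.eq_of_hasTransfiniteSum {e : Set.Iio Λ → X}
    (he : IsMonotoneSequence 𝕜 e) (hn : ∀ γ, ‖e γ‖ = 1) {x : X} {a b : Set.Iio Λ → 𝕜}
    (ha : HasTransfiniteSum (fun γ => a γ • e γ) x)
    (hb : HasTransfiniteSum (fun γ => b γ • e γ) x) : a = b := by
  obtain ⟨S, hS, hSx⟩ := ha
  obtain ⟨T, hT, hTx⟩ := hb
  have hST : IsPartialSums (fun γ => (a - b) γ • e γ) (S - T) := by
    refine ⟨by simp [hS.1, hT.1], fun γ => ?_, hS.2.2.sub hT.2.2⟩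
    simp only [Pi.sub_apply, hS.2.1 γ, hT.2.1 γ, sub_smul]
    abel
  have hzero : ∀ α ≤ Λ, (S - T) α = 0 := by
    intro α hα
    have := he _ _ hST α hα
    simpa [hSx, hTx] using this
  funext γ
  have h1 := hST.2.1 γ
  rw [hzero _ (Order.succ_le_of_lt γ.2), hzero _ γ.2.le, zero_add] at h1
  have h2 : e γ ≠ 0 := by
    intro h
    have := hn γ
    simp [h] at this
  exact sub_eq_zero.1 ((smul_eq_zero.1 h1.symm).resolve_right h2)

theorem IsMonotoneSequence.isNormalizedMonotoneLongBasic [CompleteSpace X] {e : Set.Iio Λ → X}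
    (he : IsMonotoneSequence 𝕜 e) (hn : ∀ γ, ‖e γ‖ = 1) :
    IsNormalizedMonotoneLongBasic 𝕜 e where
  norm_eq_one := hn
  monotone := he
  basic := fun _ hx => by
    obtain ⟨a, ha⟩ := he.exists_hasTransfiniteSum hn hx
    exact ⟨a, ha, fun b hb => he.eq_of_hasTransfiniteSum hn hb ha⟩

end PartialSums

/-! ### Existence of a monotone long basic sequence in a large space -/

section Existence

open Cardinal

variable {𝕜 : Type v} {X : Type u} [RCLike 𝕜] [NormedAddCommGroup X] [NormedSpace 𝕜 X]

variable (𝕜) in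
theorem mk_span_le_max (s : Set X) : #(Submodule.span 𝕜 s) ≤ max #s continuum := by
  -- Scalars are coded by pairs of reals, which avoids the universe of `𝕜` in the count.
  set φ : List (s × ℝ × ℝ) → X := fun l =>
    (l.map fun p => ((p.2.1 : 𝕜) + p.2.2 * RCLike.I) • (p.1 : X)).sum with hφ
  have hsub : (Submodule.span 𝕜 s : Set X) ⊆ Set.range φ := by
    intro x hx
    induction hx using Submodule.span_induction with
    | mem x hx => exact ⟨[(⟨x, hx⟩, 1, 0)], by simp [hφ]⟩
    | zero => exact ⟨[], by simp [hφ]⟩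
    | add x y _ _ hx hy =>
      obtain ⟨l, rfl⟩ := hx
      obtain ⟨l', rfl⟩ := hy
      exact ⟨l ++ l', by simp [hφ]⟩
    | smul t x _ hx =>
      obtain ⟨l, rfl⟩ := hx
      refine ⟨l.map fun p => (p.1, RCLike.re (t * ((p.2.1 : 𝕜) + p.2.2 * RCLike.I)),
        RCLike.im (t * ((p.2.1 : 𝕜) + p.2.2 * RCLike.I))), ?_⟩
      simp only [hφ, List.map_map, List.smul_sum, Function.comp_def, RCLike.re_add_im, mul_smul]
  refine (mk_le_mk_of_subset hsub).trans (mk_range_le.trans ((mk_list_le_max _).trans ?_))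
  have hprod : #(s × ℝ × ℝ) = #s * continuum := by
    simp [mk_real, lift_continuum]
  rw [hprod]
  refine max_le (aleph0_le_continuum.trans (le_max_right _ _)) ?_
  refine (mul_le_max _ _).trans (max_le le_rfl (aleph0_le_continuum.trans (le_max_right _ _)))

theorem exists_norm_eq_one_orthogonal {c : Cardinal.{u}} (hc : IsStrongLimit c)
    (hc' : continuum < c) (hX : c ≤ density X) (s : Set X) (hs : #s < c) :
    ∃ e : X, ‖e‖ = 1 ∧ ∀ x ∈ Submodule.span 𝕜 s, ∀ t : 𝕜, ‖x‖ ≤ ‖x + t • e‖ := by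
  choose g hg hgx using fun x : X => exists_dual_vector'' 𝕜 x
  obtain ⟨z, hz0, hz⟩ : ∃ z : X, z ≠ 0 ∧ ∀ x ∈ Submodule.span 𝕜 s, g x z = 0 := by
    -- Otherwise the norming functionals of the span separate points, so `#X ≤ 𝔠 ^ #span`, which is
    -- less than `c` as `c` is a strong limit.
    by_contra! hne
    have hinj : Function.Injective (fun (z : X) (x : Submodule.span 𝕜 s) =>
        (RCLike.re (g x z), RCLike.im (g x z))) := by
      intro z z' h
      by_contra hzz
      obtain ⟨x, hx, hx0⟩ := hne (z - z') (sub_ne_zero.2 hzz)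
      have h1 := congrFun h ⟨x, hx⟩
      simp only [Prod.mk.injEq] at h1
      exact hx0 (by rw [map_sub, RCLike.ext h1.1 h1.2, sub_self])
    have h1 := mk_le_of_injective hinj
    have h2 : #(Submodule.span 𝕜 s → ℝ × ℝ) < c := by
      have h3 : #(Submodule.span 𝕜 s → ℝ × ℝ) = continuum ^ #(Submodule.span 𝕜 s) := by
        simp [mk_real, lift_continuum]
      rw [h3, ← two_power_aleph0, ← power_mul]
      refine hc.isStrongPrelimit ((mul_le_max _ _).trans_lt ?_)
      refine max_lt (max_lt (aleph0_le_continuum.trans_lt hc') ?_)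
        (aleph0_le_continuum.trans_lt hc')
      exact (mk_span_le_max 𝕜 s).trans_lt (max_lt hs hc')
    have h3 : density X ≤ #X := csInf_le' ⟨Set.univ, dense_univ, mk_univ⟩
    exact (hX.trans (h3.trans h1)).not_gt h2
  have hzn : ‖z‖ ≠ 0 := norm_ne_zero_iff.2 hz0
  refine ⟨((‖z‖⁻¹ : ℝ) : 𝕜) • z, by simp [norm_smul, hzn], fun x hx t => ?_⟩
  have h1 : g x (x + t • ((‖z‖⁻¹ : ℝ) : 𝕜) • z) = ‖x‖ := by
    simp [hz x hx, hgx]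
  calc ‖x‖ = ‖g x (x + t • ((‖z‖⁻¹ : ℝ) : 𝕜) • z)‖ := by rw [h1]; simp
    _ ≤ _ := ((g x).le_opNorm _).trans (mul_le_of_le_one_left (norm_nonneg _) (hg x))

theorem exists_isNormalizedMonotoneLongBasic [CompleteSpace X] {c : Cardinal.{u}}
    (hc : IsStrongLimit c) (hc' : continuum < c) (hX : c ≤ density X) :
    ∃ e : Set.Iio c.ord → X, IsNormalizedMonotoneLongBasic 𝕜 e := by
  choose! F hF1 hF using exists_norm_eq_one_orthogonal (𝕜 := 𝕜) (X := X) hc hc' hX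
  -- Since `c.ord` is initial, fewer than `c` vectors precede each stage, so `F` is used only where
  -- its specification applies.
  set e : Set.Iio c.ord → X := wellFounded_lt.fix (C := fun _ => X)
    fun γ prev => F (Set.range fun δ : Set.Iio γ => prev δ δ.2) with he
  have hfix : ∀ γ, e γ = F (e '' Set.Iio γ) := by
    intro γ
    rw [he, WellFounded.fix_eq, Set.image_eq_range]
  have hcard : ∀ γ, #(e '' Set.Iio γ) < c := by
    intro γ
    rw [← lift_lt.{u, u + 1}]
    refine mk_image_le_lift.trans_lt ?_
    have h1 : #(Set.Iio γ) ≤ #(Set.Iio (γ : Ordinal.{u})) :=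
      mk_le_of_injective (f := fun δ : Set.Iio γ =>
          (⟨(δ : Set.Iio c.ord), δ.2⟩ : Set.Iio (γ : Ordinal.{u})))
        fun δ δ' h => Subtype.ext (Subtype.ext (congrArg
          (fun z : Set.Iio (γ : Ordinal.{u}) => (z : Ordinal.{u})) h))
    rw [mk_Iio_ordinal] at h1
    refine (lift_le.2 h1).trans_lt ?_
    have h2 : (γ : Ordinal.{u}).card < c := lt_ord.1 γ.2
    simpa only [lift_lift, lift_lt] using h2
  have horth : IsOrthogonalToPredecessors 𝕜 e := by
    intro γ x hx t
    rw [hfix γ]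
    exact hF _ (hcard γ) x hx t
  refine ⟨e, horth.isMonotoneSequence.isNormalizedMonotoneLongBasic fun γ => ?_⟩
  rw [hfix γ]
  exact hF1 _ (hcard γ)

end Existence

/-! ### Scales extracted from the moduli -/

section Moduli

open Filter Topology

variable {M : Type u} {N : Type v} [PseudoMetricSpace M] [PseudoMetricSpace N] {f : M → N}

theorem dist_le_toReal_of_dist_le {s : ℝ} (hs : modulusOfContinuity f s ≠ ∞) {x y : M}
    (h : dist x y ≤ s) : dist (f x) (f y) ≤ (modulusOfContinuity f s).toReal := by
  rw [dist_edist]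
  exact ENNReal.toReal_mono hs (le_iSup_of_le x (le_iSup_of_le y (le_iSup_of_le h le_rfl)))

theorem dist_le_of_lt_modulusOfExpansion {T D : ℝ}
    (hT : ENNReal.ofReal D < modulusOfExpansion f T) {x y : M} (h : dist (f x) (f y) ≤ D) :
    dist x y ≤ T := by
  by_contra! hlt
  have h1 : modulusOfExpansion f T ≤ edist (f x) (f y) :=
    iInf_le_of_le x (iInf_le_of_le y (iInf_le_of_le hlt.le le_rfl))
  rw [edist_dist] at h1
  exact (hT.trans_le h1).not_ge (ENNReal.ofReal_le_ofReal h)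

/-- The one feature of coarse and of uniform embeddings that matters here: at suitable scales,
`f` is bounded from above and from below. -/
theorem exists_scales (hf : IsCoarseEmb f ∨ IsUniformEmb f) :
    ∃ s T L : ℝ, 0 < s ∧ 0 < T ∧ 0 < L ∧ (∀ x y, dist x y ≤ s → dist (f x) (f y) ≤ L) ∧
      ∀ x y, dist (f x) (f y) ≤ 8 * L → dist x y ≤ T := by
  rcases hf with ⟨hw, hρ⟩ | ⟨hw, hρ⟩
  · set L := (modulusOfContinuity f 1).toReal + 1 with hL
    have hL0 : 0 < L := by positivity
    obtain ⟨T, hT, hT0⟩ := ((hρ.eventually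
      (lt_mem_nhds (ENNReal.ofReal_lt_top (r := 8 * L)))).and (eventually_gt_atTop 0)).exists
    refine ⟨1, T, L, one_pos, hT0, hL0, fun x y h => ?_, fun x y h =>
      dist_le_of_lt_modulusOfExpansion hT h⟩
    linarith [dist_le_toReal_of_dist_le (hw 1 one_pos).ne h]
  -- The order of choice is reversed from the coarse case: expansion at distance `1` fixes `L`, then
  -- continuity at `0` supplies `s`.
  · obtain ⟨L, hL0, hL⟩ : ∃ L : ℝ, 0 < L ∧ ENNReal.ofReal (8 * L) < modulusOfExpansion f 1 := by
      obtain ⟨r, hr0, hr⟩ := ENNReal.lt_iff_exists_nnreal_btwn.1 (hρ 1 one_pos)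
      refine ⟨r / 8, ?_, ?_⟩
      · have : (0 : ℝ) < r := by exact_mod_cast hr0
        positivity
      · rwa [mul_div_cancel₀ _ (by norm_num : (8 : ℝ) ≠ 0), ENNReal.ofReal_coe_nnreal]
    obtain ⟨s, hs, hs0⟩ := ((hw.eventually_lt_const
      (ENNReal.ofReal_pos.2 hL0)).and self_mem_nhdsWithin).exists
    refine ⟨s, 1, L, hs0, one_pos, hL0, fun x y h => ?_, fun x y h =>
      dist_le_of_lt_modulusOfExpansion hL h⟩
    refine (dist_le_toReal_of_dist_le hs.ne_top h).trans ?_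
    exact ENNReal.toReal_le_of_le_ofReal hL0.le hs.le

end Moduli

/-! ### Rounding in `c₀(Γ)` -/

section Rounding

variable {𝕜 : Type v} [RCLike 𝕜]

/-- The real and imaginary parts of `z`, rounded to the grid `4Lℤ`. -/
noncomputable def gridRound (L : ℝ) (z : 𝕜) : ℤ × ℤ :=
  (round (RCLike.re z / (4 * L)), round (RCLike.im z / (4 * L)))

theorem gridRound_eq_zero {L : ℝ} (hL : 0 < L) {z : 𝕜} (hz : ‖z‖ < 2 * L) :
    gridRound L z = 0 := by
  have key : ∀ r : ℝ, |r| ≤ ‖z‖ → round (r / (4 * L)) = 0 := by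
    intro r hr
    have h1 := abs_lt.1 (hr.trans_lt hz)
    rw [round_eq_zero_iff]
    constructor
    · rw [le_div_iff₀ (by positivity)]
      linarith
    · rw [div_lt_iff₀ (by positivity)]
      linarith
  exact Prod.ext (key _ (RCLike.abs_re_le_norm z)) (key _ (RCLike.abs_im_le_norm z))

theorem dist_le_of_gridRound_eq {L : ℝ} (hL : 0 < L) {z z' : 𝕜}
    (h : gridRound L z = gridRound L z') : dist z z' ≤ 8 * L := by
  have key : ∀ r r' : ℝ, round (r / (4 * L)) = round (r' / (4 * L)) → |r - r'| ≤ 4 * L := by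
    intro r r' h
    have h1 := abs_sub_round (r / (4 * L))
    have h2 := abs_sub_round (r' / (4 * L))
    rw [h] at h1
    have h3 : |r / (4 * L) - r' / (4 * L)| ≤ 1 := by
      rw [abs_le] at h1 h2 ⊢
      constructor <;> linarith
    rw [← sub_div, abs_div, abs_of_pos (by positivity : 0 < 4 * L),
      div_le_one (by positivity)] at h3
    exact h3
  have h1 := key _ _ (congrArg Prod.fst h)
  have h2 := key _ _ (congrArg Prod.snd h)
  rw [← map_sub] at h1 h2
  have h3 : ‖z - z'‖ ≤ |RCLike.re (z - z')| + |RCLike.im (z - z')| := by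
    conv_lhs => rw [← RCLike.re_add_im (z - z')]
    refine (norm_add_le _ _).trans (add_le_add (RCLike.norm_ofReal _).le ?_)
    rw [norm_mul, RCLike.norm_ofReal]
    exact mul_le_of_le_one_right (abs_nonneg _) (by rw [RCLike.norm_I]; split_ifs <;> simp)
  rw [dist_eq_norm]
  linarith

theorem dist_apply_le {Γ : Type w} [TopologicalSpace Γ] (g g' : C₀(Γ, 𝕜)) (γ : Γ) : dist (g γ) (g' γ) ≤ dist g g' := by
  rw [← ZeroAtInftyContinuousMap.dist_toBCF_eq_dist]
  exact BoundedContinuousFunction.dist_coe_le_dist (f := g.toBCF) (g := g'.toBCF) γ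

variable {Γ : Type w} [TopologicalSpace Γ] [DiscreteTopology Γ]

theorem finite_setOf_le_norm (g : C₀(Γ, 𝕜)) {δ : ℝ} (hδ : 0 < δ) : {γ | δ ≤ ‖g γ‖}.Finite := by
  have h := (zero_at_infty g).norm
  rw [norm_zero, Filter.cocompact_eq_cofinite] at h
  have h1 := h.eventually_lt_const hδ
  rw [Filter.eventually_cofinite] at h1
  simpa only [not_lt] using h1

/-- Finitely many maps from a product of rapidly growing sets to `c₀(Γ)`, each moving by at most
`L` when one coordinate is changed, move by at most `8L` between two suitable points that differ
in all coordinates. The bound does not depend on the number of factors. -/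
theorem exists_forall_ne_dist_le {A : ℕ → Type u}
    (hA : ∀ n, Cardinal.aleph0 ^ Cardinal.mk (∀ i : Fin n, A i) < Cardinal.mk (A n)) {n : ℕ}
    {E : Type*} [Finite E] (F : (∀ i : Fin n, A i) → E → C₀(Γ, 𝕜)) {L : ℝ} (hL : 0 < L)
    (hF : ∀ α i b ε, dist (F (Function.update α i b) ε) (F α ε) ≤ L) :
    ∃ α β, (∀ i, α i ≠ β i) ∧ ∀ ε, dist (F α ε) (F β ε) ≤ 8 * L := by
  obtain ⟨α, β, hne, heq⟩ := exists_forall_ne_eq_of_countable_lines hA n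
    -- Including `E` in the index makes a single coincidence serve every `ε`. Along a line, entries
    -- below `L` at the base point stay below `2L` and round to `0`, so the rounded functions are
    -- supported in one finite set.
    (fun α (p : E × Γ) => gridRound L (F α p.1 p.2)) (by
      intro α i
      have hfin : {p : E × Γ | L ≤ ‖F α p.1 p.2‖}.Finite := by
        have : {p : E × Γ | L ≤ ‖F α p.1 p.2‖} = ⋃ ε, Prod.mk ε '' {γ | L ≤ ‖F α ε γ‖} := by
          ext ⟨ε, γ⟩
          simp
        rw [this]
        exact Set.finite_iUnion fun ε => (finite_setOf_le_norm _ hL).image _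
      set s := {p : E × Γ | L ≤ ‖F α p.1 p.2‖}
      have : Finite s := hfin
      have hinj : Set.InjOn (fun (h : E × Γ → ℤ × ℤ) (p : s) => h p) {h | ∀ p ∉ s, h p = 0} := by
        intro h hh h' hh' heq
        funext p
        by_cases hp : p ∈ s
        · exact congrFun heq ⟨p, hp⟩
        · rw [hh p hp, hh' p hp]
      refine (Set.MapsTo.countable_of_injOn (Set.mapsTo_univ _ _) hinj Set.countable_univ).mono ?_
      rintro _ ⟨b, rfl⟩ p hp
      refine gridRound_eq_zero hL ?_
      have h1 := (dist_apply_le _ _ p.2).trans (hF α i b p.1)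
      rw [dist_eq_norm] at h1
      have h2 : ‖F α p.1 p.2‖ < L := not_le.1 hp
      linarith [norm_le_norm_add_norm_sub' (F (Function.update α i b) p.1 p.2) (F α p.1 p.2)])
  refine ⟨α, β, hne, fun ε => ?_⟩
  rw [← ZeroAtInftyContinuousMap.dist_toBCF_eq_dist,
    BoundedContinuousFunction.dist_le (by positivity)]
  exact fun γ => dist_le_of_gridRound_eq hL (congrFun heq (ε, γ))

end Rounding

/-! ### Assembly: `ℓ_∞` bases from differences of basis vectors -/

section Main

variable {𝕜 : Type v} {X : Type u} [RCLike 𝕜] [NormedAddCommGroup X] [NormedSpace 𝕜 X]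

/-- The coefficient of the combination at `α i` is exactly `a i`, so the bound on coordinate
functionals applies. -/
theorem IsMonotoneSequence.norm_le_of_sub {Λ : Ordinal.{w}} {e : Set.Iio Λ → X}
    (he : IsMonotoneSequence 𝕜 e) (hn : ∀ γ, ‖e γ‖ = 1) {n : ℕ} {α β : Fin n → Set.Iio Λ}
    (hα : Function.Injective α) (hαβ : Disjoint (Set.range α) (Set.range β)) (a : Fin n → 𝕜) :
    ‖a‖ ≤ 2 * ‖∑ i, a i • (e (α i) - e (β i))‖ := by
  classical
  refine (pi_norm_le_iff_of_nonneg (by positivity)).2 fun i => ?_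
  have h := he.norm_coeff_le hn
    (∑ j, (Finsupp.single (α j) (a j) - Finsupp.single (β j) (a j))) (α i)
  have h1 : (∑ j, (Finsupp.single (α j) (a j) - Finsupp.single (β j) (a j))) (α i) = a i := by
    rw [Finsupp.finsetSum_apply, Finset.sum_eq_single i]
    · have : β i ≠ α i := fun h => Set.disjoint_left.1 hαβ ⟨i, rfl⟩ ⟨i, h⟩
      simp [this]
    · intro j _ hj
      have h2 : β j ≠ α i := fun h => Set.disjoint_left.1 hαβ ⟨i, rfl⟩ ⟨j, h⟩
      have h3 : α j ≠ α i := fun h => hj (hα h)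
      simp [h2, h3]
    · simp
  rw [h1] at h
  simpa [map_sum, smul_sub] using h

variable {Γ : Type w} [TopologicalSpace Γ] [DiscreteTopology Γ]

theorem exists_forall_ne_norm_sum_sub_le {f : X → C₀(Γ, 𝕜)}
    {s T L : ℝ} (hs : 0 < s) (hL : 0 < L)
    (hup : ∀ x y, dist x y ≤ s → dist (f x) (f y) ≤ L)
    (hlow : ∀ x y, dist (f x) (f y) ≤ 8 * L → dist x y ≤ T)
    {A : ℕ → Type*}
    (hA : ∀ n, Cardinal.aleph0 ^ Cardinal.mk (∀ i : Fin n, A i) < Cardinal.mk (A n)) {n : ℕ}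
    (y : ∀ i : Fin n, A i → X) (hy : ∀ i b, ‖y i b‖ = 1) :
    ∃ α β : ∀ i : Fin n, A i, (∀ i, α i ≠ β i) ∧ ∀ ε : Fin n → ℤˣ,
      ‖∑ i, (ε i : ℤ) • (y i (α i) - y i (β i))‖ ≤ 2 / s * T := by
  let _ : NormedSpace ℝ X := NormedSpace.restrictScalars ℝ 𝕜 X
  obtain ⟨α, β, hne, hd⟩ := exists_forall_ne_dist_le hA
    (fun (α : ∀ i : Fin n, A i) (ε : Fin n → ℤˣ) =>
      -- Replacing one unit vector moves the sum by at most `2`; the factor `s / 2` brings this to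
      -- the scale `s`.
      f ((s / 2) • ∑ i, (ε i : ℤ) • y i (α i))) hL (by
      intro α i b ε
      refine hup _ _ ?_
      rw [dist_eq_norm, ← smul_sub, ← Finset.sum_sub_distrib, Finset.sum_eq_single i, norm_smul,
        ← smul_sub, Real.norm_of_nonneg (by positivity)]
      · have h1 : ‖(ε i : ℤ) • (y i (Function.update α i b i) - y i (α i))‖ ≤ 2 := by
          have h2 := norm_sub_le (y i (Function.update α i b i)) (y i (α i))
          rw [hy, hy] at h2
          rcases Int.units_eq_one_or (ε i) with h | h <;> rw [h]
          · simpa using h2.trans (by norm_num)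
          · rw [Units.val_neg, Units.val_one, neg_smul, one_smul, norm_neg]
            exact h2.trans (by norm_num)
        nlinarith
      · intro j _ hj
        rw [Function.update_of_ne hj, sub_self]
      · simp)
  refine ⟨α, β, hne, fun ε => ?_⟩
  have h1 := hlow _ _ (hd ε)
  rw [dist_eq_norm, ← smul_sub, ← Finset.sum_sub_distrib, norm_smul,
    Real.norm_of_nonneg (by positivity)] at h1
  simp only [smul_sub]
  rw [div_mul_eq_mul_div, le_div_iff₀ hs]
  linarith

theorem exists_isLinftyBasis_sub {f : X → C₀(Γ, 𝕜)} (hf : IsCoarseEmb f ∨ IsUniformEmb f)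
    {e : Set.Iio (Cardinal.beth.{u} Ordinal.omega0).ord → X}
    (hn : ∀ γ, ‖e γ‖ = 1) (he : IsMonotoneSequence 𝕜 e) :
    ∃ C : ℝ, 1 < C ∧ ∀ n : ℕ, ∃ α β : Fin n → Set.Iio (Cardinal.beth.{u} Ordinal.omega0).ord,
      StrictMono α ∧ StrictMono β ∧ Disjoint (Set.range α) (Set.range β) ∧
      IsLinftyBasis 𝕜 C (fun i => e (α i) - e (β i)) := by
  obtain ⟨s, T, L, hs, hT, hL, hup, hlow⟩ := exists_scales hf
  -- The factor `2` is the cost of passing from signs to scalars, and `+ 1` ensures `B > 1`. With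
  -- lower constant `1 / 2` the ratio is `2 * B`.
  set B : ℝ := 2 * (2 / s * T) + 1 with hB
  have hB0 : 1 < B := by
    have : 0 < 2 * (2 / s * T) := by positivity
    linarith
  refine ⟨2 * B, by linarith, fun n => ?_⟩
  let ι : ∀ i : Fin n, bethBlock.{u} i → Set.Iio (Cardinal.beth.{u} Ordinal.omega0).ord :=
    fun i x => ⟨x, lt_of_mem_bethBlock_omega x.2⟩
  have hι : ∀ {i j : Fin n}, i < j → ∀ x y, ι i x < ι j y := fun h x y =>
    lt_of_mem_bethBlock h x.2 y.2
  obtain ⟨α, β, hne, hαβ⟩ := exists_forall_ne_norm_sum_sub_le hs hL hup hlow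
    (A := fun i => bethBlock.{u} i) aleph0_power_pi_bethBlock_lt (n := n)
    (fun i x => e (ι i x)) (fun i x => hn _)
  have hαm : StrictMono fun i => ι i (α i) := fun i j h => hι h _ _
  have hβm : StrictMono fun i => ι i (β i) := fun i j h => hι h _ _
  have hdisj : Disjoint (Set.range fun i => ι i (α i)) (Set.range fun i => ι i (β i)) := by
    rw [Set.disjoint_left]
    rintro _ ⟨i, rfl⟩ ⟨j, hj⟩
    rcases lt_trichotomy i j with h | rfl | h
    · exact (hι h (α i) (β j)).ne' hj
    · exact hne i (Subtype.ext (congrArg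
        (fun z : Set.Iio (Cardinal.beth.{u} Ordinal.omega0).ord => (z : Ordinal.{u})) hj).symm)
    · exact (hι h (β j) (α i)).ne hj
  refine ⟨_, _, hαm, hβm, hdisj, 1 / 2, B, by norm_num, by linarith, by linarith, fun a => ⟨?_, ?_⟩⟩
  · linarith [he.norm_le_of_sub hn hαm.injective hdisj a]
  · refine (norm_sum_smul_le_of_signs _ hαβ a).trans ?_
    exact mul_le_mul_of_nonneg_right (by linarith) (norm_nonneg _)

theorem isStrongLimit_beth_omega0 : Cardinal.IsStrongLimit (Cardinal.beth.{u} Ordinal.omega0) :=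
  Cardinal.isStrongLimit_beth.2 Ordinal.isSuccLimit_omega0.isSuccPrelimit

theorem continuum_lt_beth_omega0 : Cardinal.continuum < Cardinal.beth.{u} Ordinal.omega0 := by
  rw [← Cardinal.beth_one]
  exact Cardinal.beth_strictMono Ordinal.one_lt_omega0

end Main

end CoarseC0

theorem theoremA {𝕜 : Type v} [RCLike 𝕜]
    {X : Type u} [NormedAddCommGroup X] [NormedSpace 𝕜 X] [CompleteSpace X]
    (hdens : Cardinal.beth.{u} Ordinal.omega0 ≤ CoarseC0.density X)
    {Γ : Type w} [TopologicalSpace Γ] [DiscreteTopology Γ]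
    (f : X → C₀(Γ, 𝕜)) (hf : CoarseC0.IsCoarseEmb f ∨ CoarseC0.IsUniformEmb f) :
    ¬ CoarseC0.HasNontrivialCotype X ∧
    (∀ C : ℝ, 1 < C → CoarseC0.ContainsLinftyUniformly 𝕜 X C) ∧
    (∃ e : Set.Iio (Cardinal.beth.{u} Ordinal.omega0).ord → X,
      CoarseC0.IsNormalizedMonotoneLongBasic 𝕜 e) ∧
    (∀ e : Set.Iio (Cardinal.beth.{u} Ordinal.omega0).ord → X,
      CoarseC0.IsNormalizedMonotoneLongBasic 𝕜 e →
      ∃ C : ℝ, 1 < C ∧ ∀ n : ℕ, ∃ α β : Fin n → Set.Iio (Cardinal.beth.{u} Ordinal.omega0).ord,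
        StrictMono α ∧ StrictMono β ∧ Disjoint (Set.range α) (Set.range β) ∧
        CoarseC0.IsLinftyBasis 𝕜 C (fun i => e (α i) - e (β i))) := by
  obtain ⟨e, he⟩ := CoarseC0.exists_isNormalizedMonotoneLongBasic (𝕜 := 𝕜)
    CoarseC0.isStrongLimit_beth_omega0 CoarseC0.continuum_lt_beth_omega0 hdens
  obtain ⟨C₀, -, hC₀⟩ := CoarseC0.exists_isLinftyBasis_sub hf he.norm_eq_one he.monotone
  have hunif : CoarseC0.ContainsLinftyUniformly 𝕜 X C₀ := fun n => by
    obtain ⟨α, β, -, -, -, h⟩ := hC₀ n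
    exact ⟨_, h⟩
  exact ⟨hunif.not_hasNontrivialCotype, fun C hC => hunif.of_one_lt hC, ⟨e, he⟩,
    fun e he => CoarseC0.exists_isLinftyBasis_sub hf he.norm_eq_one he.monotone⟩
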